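/- Let $n\in\mathbb N$, let $\|\cdot\|$ be a submultiplicative norm on the algebra $\mathrm M_n(\mathbb C)$ (for instance, the operator norm coming from a norm on $\mathbb C^n$), let $\varepsilon_0>0$, and let $T:\left]-\varepsilon_0,\varepsilon_0\right[\to \mathrm M_n(\mathbb C)$ be a (real-)analytic function such that $1\in\operatorname{spec}T(\varepsilon)$ and $\|T(\varepsilon)\|=1$ for all $\varepsilon\in\left]-\varepsilon_0,\varepsilon_0\right[$. For a matrix $A\in\mathrm M_n(\mathbb C)$ and $\mu\in\mathbb C$, the spectral projection of $A$ for $\mu$ is the projection of $\mathbb C^n$ onto the generalized eigenspace of $A$ for $\mu$ along the sum of the generalized eigenspaces of $A$ for all other eigenvalues. For each $\varepsilon\in\left]-\varepsilon_0,\varepsilon_0\right[$, let $P(\varepsilon)$ be the spectral projection of $T(\varepsilon)$ for $1$, and suppose that $T(\varepsilon)^k\to P(\varepsilon)$ as $k\to\infty$ whenever $0<\varepsilon<\varepsilon_0$. Then: 1. $0\in\operatorname{spec}P(0)T'(0)P(0)$. Let $Q$ be the spectral projection of $P(0)T'(0)P(0)$ for $0$. 2. $P(0)Q=QP(0)$,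 so $P(0)Q$ is a projection, too. 3. The limit $P(0^+)=\lim_{\varepsilon\searrow0}P(\varepsilon)$ exists and is a sub-projection of $P(0)Q$; that is, $P(0^+)$ is a (not necessarily orthogonal) projection with $P(0^+)=P(0)Q\,P(0^+)=P(0^+)\,P(0)Q$. -/

import Mathlib

/-- For an endomorphism of a finite-dimensional complex vector space, the generalized eigenspace of
`μ` and the sum of the generalized eigenspaces of all other complex numbers are complementary. -/
theorem isCompl_maxGenEigenspace {V : Type*} [AddCommGroup V] [Module ℂ V] [FiniteDimensional ℂ V]
    (f : Module.End ℂ V) (μ : ℂ) :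
    IsCompl (f.maxGenEigenspace μ) (⨆ ν, ⨆ (_ : ν ≠ μ), f.maxGenEigenspace ν) := by
  refine ⟨f.independent_maxGenEigenspace μ, codisjoint_iff.mpr (eq_top_iff.mpr ?_)⟩
  rw [← Module.End.iSup_maxGenEigenspace_eq_top f]
  refine iSup_le fun ν => ?_
  by_cases h : ν = μ
  · subst h
    exact le_sup_left
  · exact le_sup_of_le_right (le_iSup₂_of_le ν h le_rfl)

/-- The spectral projection (eigenprojection, Riesz projection) of the complex matrix `A` for the
point `μ`: the projection of `ℂⁿ` onto the generalized eigenspace of `A` for `μ` along the sum of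
the generalized eigenspaces of `A` for all the other eigenvalues (it is `0` if `μ` is not an
eigenvalue). -/
noncomputable def spectralProjection {n : ℕ} (A : Matrix (Fin n) (Fin n) ℂ) (μ : ℂ) :
    Matrix (Fin n) (Fin n) ℂ :=
  LinearMap.toMatrix' (Submodule.projection _ _ (isCompl_maxGenEigenspace (Matrix.toLin' A) μ))

/-- The derivative at `x` of a matrix-valued function of a real variable, entry by entry. -/
noncomputable def matrixDeriv {n : ℕ} (T : ℝ → Matrix (Fin n) (Fin n) ℂ) (x : ℝ) :
    Matrix (Fin n) (Fin n) ℂ :=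
  Matrix.of fun i j => deriv (fun ε => T ε i j) x

/-- `R` is a sub-projection of `S`: both are (not necessarily orthogonal) projections, and
`R = S R = R S`. -/
def IsSubprojection {n : ℕ} (R S : Matrix (Fin n) (Fin n) ℂ) : Prop :=
  IsIdempotentElem R ∧ IsIdempotentElem S ∧ S * R = R ∧ R * S = R

/-!
The matrices `P ε`, `ε > 0`, are idempotents of norm exactly `1`: nonzero idempotents have norm at
least `1`, and limits of powers of contractions have norm at most `1`. On the other hand their
entries are meromorphic at `0` (`exists_meromorphicAt_spectralProjection`). Indeed, a contraction
has `1` as a semisimple eigenvalue (`AlgebraNorm.sub_one_mul_spectralProjection`), so if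
`X ^ m * q` is the characteristic polynomial of `T ε - 1` and `m` is the generic multiplicity, then
`q (T ε - 1) = q 0 • P ε` (`aeval_sub_one_eq_smul_spectralProjection`), and the coefficients of
`q` are analytic in `ε`. A meromorphic function that is bounded on one side of a point has a limit
there, so `P ε` converges to some `P₀` as `ε ↘ 0`, and `P₀` is a nonzero idempotent because `N` is
continuous.

From `(T ε - 1) * P ε = 0 = P 0 * (T 0 - 1)` one gets `P 0 * (ε⁻¹ • (T ε - T 0)) * P ε = 0`, hence
`P 0 * T' 0 * P₀ = 0` in the limit, and symmetrically `P₀ * T' 0 * P 0 = 0`. Also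
`P 0 * P₀ = P₀ = P₀ * P 0`, since `P₀` is annihilated on both sides by `T 0 - 1`. So `P₀` is
annihilated on both sides by `B = P 0 * T' 0 * P 0`. As `P₀ ≠ 0`, this makes `B` singular, and it
gives `Q * P₀ = P₀ = P₀ * Q` for the spectral projection `Q` of `B` for `0`
(`spectralProjection_mul_eq_self`, `mul_spectralProjection_eq_self`). Finally `P 0` commutes
with `B`, hence with `Q`.
-/

/-! ### Spectral projections of matrices -/

section SpectralProjection

variable {n : ℕ} (A : Matrix (Fin n) (Fin n) ℂ) (μ : ℂ)

theorem toLin'_spectralProjection :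
    Matrix.toLin' (spectralProjection A μ) =
      Submodule.projection _ _ (isCompl_maxGenEigenspace (Matrix.toLin' A) μ) := by
  simp [spectralProjection]

theorem isIdempotentElem_spectralProjection : IsIdempotentElem (spectralProjection A μ) := by
  apply Matrix.toLin'.injective
  rw [Matrix.toLin'_mul, toLin'_spectralProjection]
  exact Submodule.isIdempotentElem_projection _

theorem Commute.spectralProjection_right {C : Matrix (Fin n) (Fin n) ℂ} (h : Commute C A) :
    Commute C (spectralProjection A μ) := by
  have hf : Commute (Matrix.toLin' A) (Matrix.toLin' C) := by
    change _ * _ = _ * _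
    rw [Module.End.mul_eq_comp, Module.End.mul_eq_comp, ← Matrix.toLin'_mul, ← Matrix.toLin'_mul,
      h.eq]
  have hc := isCompl_maxGenEigenspace (Matrix.toLin' A) μ
  have hE := Module.End.mapsTo_maxGenEigenspace_of_comm hf
  have hW : ∀ w ∈ ⨆ ν, ⨆ (_ : ν ≠ μ), Module.End.maxGenEigenspace (Matrix.toLin' A) ν,
      Matrix.toLin' C w ∈ ⨆ ν, ⨆ (_ : ν ≠ μ), Module.End.maxGenEigenspace (Matrix.toLin' A) ν := by
    suffices H : (⨆ ν, ⨆ (_ : ν ≠ μ), Module.End.maxGenEigenspace (Matrix.toLin' A) ν) ≤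
        (⨆ ν, ⨆ (_ : ν ≠ μ), Module.End.maxGenEigenspace (Matrix.toLin' A) ν).comap
          (Matrix.toLin' C) from
      fun w hw => H hw
    exact iSup₂_le fun ν hν x hx => Submodule.mem_comap.mpr
      (le_iSup₂_of_le (f := fun ν (_ : ν ≠ μ) => Module.End.maxGenEigenspace (Matrix.toLin' A) ν)
        ν hν le_rfl (hE ν hx))
  apply Matrix.toLin'.injective
  rw [Matrix.toLin'_mul, Matrix.toLin'_mul, toLin'_spectralProjection]
  refine LinearMap.ext fun x => ?_
  obtain ⟨u, hu, w, hw, rfl⟩ := Submodule.mem_sup.mp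
    (show x ∈ _ ⊔ _ by rw [hc.sup_eq_top]; trivial)
  simp only [LinearMap.comp_apply, map_add]
  rw [Submodule.projection_apply_of_mem_left _ hu, Submodule.projection_apply_of_mem_right _ hw,
    Submodule.projection_apply_of_mem_left _ (hE μ hu),
    Submodule.projection_apply_of_mem_right _ (hW w hw), map_zero]

/-- The spectral projection fixes the eigenvectors for `μ`, here the columns of `M`. -/
theorem spectralProjection_mul_eq_self {M : Matrix (Fin n) (Fin n) ℂ}
    (h : (A - Matrix.scalar (Fin n) μ) * M = 0) : spectralProjection A μ * M = M := by
  apply Matrix.toLin'.injective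
  rw [Matrix.toLin'_mul, toLin'_spectralProjection]
  refine LinearMap.ext fun x => ?_
  rw [LinearMap.comp_apply]
  apply Submodule.projection_apply_of_mem_left
  apply Module.End.genEigenspace_le_maximal _ _ 1
  refine Module.End.mem_eigenspace_iff.mpr ?_
  have := congrArg (fun L => Matrix.toLin' L x) h
  simpa [sub_mul, sub_eq_zero, ← Matrix.smul_eq_diagonal_mul, Matrix.smul_mulVec] using this

/-- The spectral projection fixes the left eigenvectors for `μ`, here the rows of `M`: they vanish
on the range of `A - μ`, which contains the generalized eigenspaces for all other points. -/
theorem mul_spectralProjection_eq_self {M : Matrix (Fin n) (Fin n) ℂ}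
    (h : M * (A - Matrix.scalar (Fin n) μ) = 0) : M * spectralProjection A μ = M := by
  have hc := isCompl_maxGenEigenspace (Matrix.toLin' A) μ
  have hW : (⨆ ν, ⨆ (_ : ν ≠ μ), Module.End.maxGenEigenspace (Matrix.toLin' A) ν) ≤
      LinearMap.ker (Matrix.toLin' M) := by
    refine iSup₂_le fun ν hν x hx => ?_
    obtain ⟨k, hk⟩ := (Module.End.mem_maxGenEigenspace _ _ _).mp hx
    have hco : IsCoprime (Polynomial.X - Polynomial.C μ) ((Polynomial.X - Polynomial.C ν) ^ k) :=
      (Polynomial.isCoprime_X_sub_C_of_isUnit_sub (sub_ne_zero.mpr hν.symm).isUnit).pow_right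
    obtain ⟨a, b, hab⟩ := hco
    -- On the generalized eigenspace for `ν ≠ μ`, the Bézout identity writes every vector as a
    -- value of `A - μ`, which `M` annihilates.
    have h1 := congrArg (fun q => Matrix.toLin' M (Polynomial.aeval (Matrix.toLin' A) q x)) hab
    have h2 : ∀ y, Matrix.toLin' M (Matrix.toLin' A y - μ • y) = 0 := by
      intro y
      have := congrArg (fun L => Matrix.toLin' L y) h
      simpa [mul_sub, sub_eq_zero, Matrix.mulVec_sub, Matrix.mulVec_smul] using this
    have h3 : Polynomial.aeval (Matrix.toLin' A) ((Polynomial.X - Polynomial.C ν) ^ k) x = 0 := by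
      simpa [Algebra.algebraMap_eq_smul_one] using hk
    rw [mul_comm a] at h1
    simp only [map_add, map_mul, LinearMap.add_apply, Module.End.mul_apply, h3, map_zero,
      add_zero, map_one, Module.End.one_apply] at h1
    rw [LinearMap.mem_ker, ← h1]
    simpa using h2 (Polynomial.aeval (Matrix.toLin' A) a x)
  apply Matrix.toLin'.injective
  rw [Matrix.toLin'_mul, toLin'_spectralProjection]
  refine LinearMap.ext fun x => ?_
  obtain ⟨u, hu, w, hw, rfl⟩ := Submodule.mem_sup.mp
    (show x ∈ _ ⊔ _ by rw [hc.sup_eq_top]; trivial)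
  simp only [LinearMap.comp_apply, map_add]
  rw [Submodule.projection_apply_of_mem_left _ hu, Submodule.projection_apply_of_mem_right _ hw,
    map_zero, LinearMap.mem_ker.mp (hW hw)]

theorem sub_scalar_pow_mul_spectralProjection :
    (A - Matrix.scalar (Fin n) μ) ^ n * spectralProjection A μ = 0 := by
  apply Matrix.toLin'.injective
  rw [Matrix.toLin'_mul, toLin'_spectralProjection, Matrix.toLin'_pow]
  refine LinearMap.ext fun x => ?_
  have hx := Submodule.projection_apply_mem (isCompl_maxGenEigenspace (Matrix.toLin' A) μ) x
  replace hx := (Module.End.maxGenEigenspace_eq_genEigenspace_finrank (Matrix.toLin' A) μ).le hx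
  rw [Module.End.mem_genEigenspace_nat] at hx
  have e : Matrix.toLin' (A - Matrix.scalar (Fin n) μ) = Matrix.toLin' A - μ • 1 := by
    refine LinearMap.ext fun y => ?_
    simp
  rw [e, LinearMap.comp_apply]
  simpa using hx

theorem spectralProjection_ne_zero {A : Matrix (Fin n) (Fin n) ℂ} {μ : ℂ} (h : μ ∈ spectrum ℂ A) :
    spectralProjection A μ ≠ 0 := by
  intro h0
  rw [← Matrix.spectrum_toLin', ← Module.End.hasEigenvalue_iff_mem_spectrum] at h
  obtain ⟨v, hv, hv0⟩ := h.exists_hasEigenvector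
  have h1 := Submodule.projection_apply_of_mem_left (isCompl_maxGenEigenspace (Matrix.toLin' A) μ)
    (Module.End.genEigenspace_le_maximal _ _ 1 hv)
  rw [← toLin'_spectralProjection, h0, map_zero] at h1
  exact hv0 h1.symm

end SpectralProjection

/-! ### Submultiplicative norms and contractions -/

section Norm

variable {n : ℕ} (N : AlgebraNorm ℂ (Matrix (Fin n) (Fin n) ℂ))

/-- Continuity with respect to the entrywise topology of matrices. -/
theorem AlgebraNorm.continuous_matrix : Continuous N := by
  have key : Continuous N.toSeminorm := by
    apply Seminorm.continuous_of_continuousAt_zero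
    have hb : ∀ A : Matrix (Fin n) (Fin n) ℂ,
        N.toSeminorm A ≤ ∑ i, ∑ j, ‖A i j‖ * N.toSeminorm (Matrix.single i j 1) := by
      intro A
      conv_lhs => rw [Matrix.matrix_eq_sum_single A]
      refine (Finset.le_sum_of_subadditive N.toSeminorm (map_zero _).le
        (map_add_le_add _) _ _).trans (Finset.sum_le_sum fun i _ => ?_)
      refine (Finset.le_sum_of_subadditive N.toSeminorm (map_zero _).le
        (map_add_le_add _) _ _).trans (Finset.sum_le_sum fun j _ => ?_)
      rw [← map_smul_eq_mul, Matrix.smul_single, smul_eq_mul, mul_one]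
    have hc : Continuous fun A : Matrix (Fin n) (Fin n) ℂ =>
        ∑ i, ∑ j, ‖A i j‖ * N.toSeminorm (Matrix.single i j 1) := by
      fun_prop
    have h0 := hc.tendsto 0
    simp only [Matrix.zero_apply, norm_zero, zero_mul, Finset.sum_const_zero] at h0
    unfold ContinuousAt
    rw [map_zero]
    exact squeeze_zero (fun A => apply_nonneg _ _) hb h0
  exact key

/-- A linear functional on a finite-dimensional space is bounded with respect to any norm. The
space carries no topology here, so that the lemma applies to matrices without interfering with
their entrywise topology. -/
theorem exists_norm_le_mul_of_seminorm {V : Type*} [AddCommGroup V] [Module ℂ V]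
    [FiniteDimensional ℂ V] (p : Seminorm ℂ V) (hp : ∀ x, p x = 0 → x = 0) (f : V →ₗ[ℂ] ℂ) :
    ∃ C : ℝ, ∀ x, ‖f x‖ ≤ C * p x := by
  let _ : NormedAddCommGroup V := AddGroupNorm.toNormedAddCommGroup
    { p.toAddGroupSeminorm with eq_zero_of_map_eq_zero' := hp }
  let _ : NormedSpace ℂ V := ⟨fun a x => (map_smul_eq_mul p a x).le⟩
  exact ⟨‖f.toContinuousLinearMap‖, f.toContinuousLinearMap.le_opNorm⟩

theorem AlgebraNorm.exists_entry_le (i j : Fin n) :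
    ∃ C : ℝ, ∀ A : Matrix (Fin n) (Fin n) ℂ, ‖A i j‖ ≤ C * N A :=
  exists_norm_le_mul_of_seminorm N.toSeminorm (fun _ hx => eq_zero_of_map_eq_zero N hx)
    (Matrix.entryLinearMap ℂ ℂ i j)

variable {N} {A : Matrix (Fin n) (Fin n) ℂ}

theorem AlgebraNorm.pow_succ_le_one (hA : N A ≤ 1) (k : ℕ) : N (A ^ (k + 1)) ≤ 1 := by
  induction k with
  | zero => simpa using hA
  | succ k ih =>
    rw [pow_succ]
    exact (map_mul_le_mul N _ _).trans (mul_le_one₀ ih (apply_nonneg _ _) hA)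

/-- A contraction `A` has no Jordan chains of length two for `1`: if `(A - 1) ^ 2` annihilates `M`,
then `A ^ k * M = M + k • (A - 1) * M` stays bounded only if `(A - 1) * M = 0`. -/
theorem AlgebraNorm.sub_one_mul_eq_zero_of_sq (hA : N A ≤ 1) {M : Matrix (Fin n) (Fin n) ℂ}
    (h : (A - 1) * ((A - 1) * M) = 0) : (A - 1) * M = 0 := by
  have hfix : A * ((A - 1) * M) = (A - 1) * M := by
    rw [← sub_eq_zero]
    simpa [sub_mul] using h
  have hpow : ∀ k : ℕ, A ^ k * M = M + (k : ℂ) • ((A - 1) * M) := by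
    intro k
    induction k with
    | zero => simp
    | succ k ih =>
      rw [pow_succ', mul_assoc, ih, mul_add, Matrix.mul_smul, hfix]
      push_cast
      rw [add_smul, one_smul, sub_mul, one_mul]
      abel
  have hle : ∀ k : ℕ, (k + 1 : ℝ) * N ((A - 1) * M) ≤ 2 * N M := by
    intro k
    have e : ((k + 1 : ℕ) : ℂ) • ((A - 1) * M) = A ^ (k + 1) * M - M := by
      rw [hpow]; abel
    have e2 : N (((k + 1 : ℕ) : ℂ) • ((A - 1) * M)) = (k + 1 : ℝ) * N ((A - 1) * M) := by
      rw [map_smul_eq_mul, Complex.norm_natCast]; push_cast; ring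
    rw [← e2, e]
    refine (map_sub_le_add N _ _).trans ?_
    have := (map_mul_le_mul N (A ^ (k + 1)) M).trans
      (mul_le_mul_of_nonneg_right (pow_succ_le_one hA k) (apply_nonneg N M))
    linarith
  by_contra hne
  have hpos : 0 < N ((A - 1) * M) :=
    lt_of_le_of_ne (apply_nonneg _ _) fun h0 => hne (eq_zero_of_map_eq_zero N h0.symm)
  obtain ⟨k, hk⟩ := exists_nat_gt (2 * N M / N ((A - 1) * M))
  rw [div_lt_iff₀ hpos] at hk
  linarith [hle k]

/-- The eigenvalue `1` of a contraction is semisimple. -/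
theorem AlgebraNorm.sub_one_mul_spectralProjection (hA : N A ≤ 1) :
    (A - 1) * spectralProjection A 1 = 0 := by
  have h := sub_scalar_pow_mul_spectralProjection A 1
  rw [map_one] at h
  have : ∀ k : ℕ, (A - 1) ^ k * spectralProjection A 1 = 0 →
      (A - 1) * spectralProjection A 1 = 0 := by
    intro k
    induction k with
    | zero =>
      intro h
      rw [pow_zero, one_mul] at h
      rw [h, mul_zero]
    | succ k ih =>
      intro h
      cases k with
      | zero => simpa using h
      | succ k =>
        apply ih
        have := sub_one_mul_eq_zero_of_sq hA (M := (A - 1) ^ k * spectralProjection A 1)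
          (by rwa [← mul_assoc (A - 1) (_ ^ k), ← pow_succ', ← mul_assoc, ← pow_succ'])
        rwa [← mul_assoc, ← pow_succ'] at this
  exact this n h

theorem commute_spectralProjection (A : Matrix (Fin n) (Fin n) ℂ) (μ : ℂ) :
    Commute A (spectralProjection A μ) := (Commute.refl A).spectralProjection_right A μ

theorem AlgebraNorm.spectralProjection_mul_sub_one (hA : N A ≤ 1) :
    spectralProjection A 1 * (A - 1) = 0 := by
  rw [mul_sub, ← (commute_spectralProjection A 1).eq, mul_one, ← sub_one_mul,
    sub_one_mul_spectralProjection hA]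

theorem AlgebraNorm.one_le_of_isIdempotentElem {R : Matrix (Fin n) (Fin n) ℂ}
    (hR : IsIdempotentElem R) (h0 : R ≠ 0) : 1 ≤ N R := by
  have hpos : 0 < N R :=
    lt_of_le_of_ne (apply_nonneg _ _) fun h => h0 (eq_zero_of_map_eq_zero N h.symm)
  have h := map_mul_le_mul N R R
  rw [hR.eq] at h
  exact (le_mul_iff_one_le_left hpos).mp h

end Norm

/-! ### Meromorphy of the spectral projection -/

section Analytic

open Filter Topology

/-- If `X ^ m` divides the characteristic polynomial of `A - 1`, with cofactor `q`, and the
eigenvalue `1` of `A` is semisimple, then `q (A - 1)` is `q 0` times the spectral projection. -/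
theorem aeval_sub_one_eq_smul_spectralProjection {n : ℕ} {A : Matrix (Fin n) (Fin n) ℂ}
    (hA : spectralProjection A 1 * (A - 1) = 0) {m : ℕ} {q : Polynomial ℂ}
    (hq : (A - 1).charpoly = Polynomial.X ^ m * q) :
    Polynomial.aeval (A - 1) q = q.coeff 0 • spectralProjection A 1 := by
  have hfix : ∀ M : Matrix (Fin n) (Fin n) ℂ, M * (A - 1) = 0 →
      M * spectralProjection A 1 = M := fun M hM =>
    mul_spectralProjection_eq_self A 1 (by rwa [map_one])
  have hcomm := commute_spectralProjection A 1
  have h2 : (A - 1) * spectralProjection A 1 = 0 := by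
    rw [sub_one_mul, hcomm.eq, ← mul_sub_one, hA]
  -- Semisimplicity lowers every positive power of `A - 1` in `q (A - 1) * (A - 1) ^ k = 0` to
  -- the first; the Cayley-Hamilton theorem provides such a `k`.
  have hdesc : ∀ k : ℕ, Polynomial.aeval (A - 1) q * (A - 1) ^ k = 0 →
      Polynomial.aeval (A - 1) q * (A - 1) = 0 := by
    intro k
    induction k with
    | zero =>
      intro h
      rw [pow_zero, mul_one] at h
      rw [h, zero_mul]
    | succ k ih =>
      intro h
      cases k with
      | zero => simpa using h
      | succ k =>
        apply ih
        have h1 := hfix (Polynomial.aeval (A - 1) q * (A - 1) ^ (k + 1))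
          (by rw [mul_assoc, ← pow_succ, h])
        rw [← h1, pow_succ, mul_assoc, mul_assoc, h2, mul_zero, mul_zero]
  have hzero : Polynomial.aeval (A - 1) q * (A - 1) ^ m = 0 := by
    have := Matrix.aeval_self_charpoly (A - 1)
    rwa [hq, mul_comm, map_mul, map_pow, Polynomial.aeval_X] at this
  have hR := hfix _ (hdesc m hzero)
  rw [← hR]
  conv_lhs => rw [← Polynomial.divX_mul_X_add q]
  rw [map_add, map_mul, Polynomial.aeval_X, Polynomial.aeval_C, add_mul, mul_assoc, h2, mul_zero,
    zero_add, Algebra.algebraMap_eq_smul_one, smul_mul_assoc, one_mul]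

theorem analyticAt_charpoly_coeff {n : ℕ} {S : ℝ → Matrix (Fin n) (Fin n) ℂ} {x : ℝ}
    (hS : ∀ i j, AnalyticAt ℝ (fun ε => S ε i j) x) (k : ℕ) :
    AnalyticAt ℝ (fun ε => (S ε).charpoly.coeff k) x := by
  have h := AnalyticAt.aeval_mvPolynomial (f := fun ε (p : Fin n × Fin n) => S ε p.1 p.2)
    (fun p => hS p.1 p.2) ((Matrix.charpoly.univ ℂ (Fin n)).coeff k)
  refine h.congr (Eventually.of_forall fun ε => ?_)
  exact Matrix.charpoly.univ_coeff_eval₂Hom (Fin n) (algebraMap ℂ ℂ) (fun p => S ε p.1 p.2) k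

theorem analyticAt_pow_apply {n : ℕ} {S : ℝ → Matrix (Fin n) (Fin n) ℂ} {x : ℝ}
    (hS : ∀ i j, AnalyticAt ℝ (fun ε => S ε i j) x) (k : ℕ) (i j : Fin n) :
    AnalyticAt ℝ (fun ε => (S ε ^ k) i j) x := by
  induction k generalizing i j with
  | zero => simpa using analyticAt_const
  | succ k ih =>
    simp only [pow_succ, Matrix.mul_apply]
    exact Finset.analyticAt_fun_sum _ fun l _ => (ih i l).mul (hS l j)

/-- A meromorphic function that is bounded on one side of a point has a limit there. -/
theorem MeromorphicAt.exists_tendsto_of_bounded {f : ℝ → ℂ} {x C : ℝ} (hf : MeromorphicAt f x)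
    (hC : ∀ᶠ y in 𝓝[>] x, ‖f y‖ ≤ C) : ∃ c, Tendsto f (𝓝[>] x) (𝓝 c) := by
  have hle : 𝓝[>] x ≤ 𝓝[≠] x := nhdsWithin_mono x fun y hy => ne_of_gt hy
  rcases lt_or_ge (meromorphicOrderAt f x) 0 with h | h
  · have ht := tendsto_norm_atTop_iff_cobounded.mpr
      ((tendsto_cobounded_of_meromorphicOrderAt_neg h).mono_left hle)
    obtain ⟨y, hy, hy'⟩ := (hC.and (ht.eventually_gt_atTop C)).exists
    exact absurd hy (not_le.mpr hy')
  · obtain ⟨c, hc⟩ := tendsto_nhds_of_meromorphicOrderAt_nonneg hf h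
    exact ⟨c, hc.mono_left hle⟩

/-- Along an analytic family of matrices for which, to the right of `x`, the eigenvalue `1` is
semisimple, the entries of the spectral projection for `1` agree there with meromorphic functions:
they are quotients of entries of `q (T ε - 1)` by `q 0`, where `X ^ m * q` is the characteristic
polynomial of `T ε - 1` and `m` is the largest exponent that works for all `ε` near `x`. -/
theorem exists_meromorphicAt_spectralProjection {n : ℕ} {T : ℝ → Matrix (Fin n) (Fin n) ℂ} {x : ℝ}
    (hT : ∀ i j, AnalyticAt ℝ (fun ε => T ε i j) x)
    (hs : ∀ᶠ ε in 𝓝[>] x, spectralProjection (T ε) 1 * (T ε - 1) = 0) :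
    ∃ F : Fin n → Fin n → ℝ → ℂ, (∀ i j, MeromorphicAt (F i j) x) ∧
      ∀ᶠ ε in 𝓝[>] x, ∀ i j, spectralProjection (T ε) 1 i j = F i j ε := by
  classical
  have hle : 𝓝[>] x ≤ 𝓝[≠] x := nhdsWithin_mono x fun y hy => ne_of_gt hy
  have hS : ∀ i j, AnalyticAt ℝ (fun ε => (T ε - 1) i j) x := fun i j => by
    exact (hT i j).sub analyticAt_const
  have hc := analyticAt_charpoly_coeff hS
  have hex : ∃ k, ¬ ∀ᶠ ε in 𝓝 x, (T ε - 1).charpoly.coeff k = 0 := by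
    refine ⟨n, fun h => ?_⟩
    obtain ⟨ε, hε⟩ := h.exists
    have h1 := (T ε - 1).charpoly_monic.leadingCoeff
    rw [Polynomial.leadingCoeff, Matrix.charpoly_natDegree_eq_dim, Fintype.card_fin, hε] at h1
    exact zero_ne_one h1
  -- The generic algebraic multiplicity of the eigenvalue `1`.
  let m := Nat.find hex
  have hm : ∀ᶠ ε in 𝓝[>] x, (T ε - 1).charpoly.coeff m ≠ 0 :=
    hle (((hc m).eventually_eq_zero_or_eventually_ne_zero).resolve_left (Nat.find_spec hex))
  have hlt : ∀ᶠ ε in 𝓝[>] x, ∀ k ∈ Finset.range m, (T ε - 1).charpoly.coeff k = 0 := by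
    rw [Filter.eventually_all_finset]
    exact fun k hk => nhdsWithin_le_nhds (not_not.mp (Nat.find_min hex (Finset.mem_range.mp hk)))
  refine ⟨fun i j ε => (∑ k ∈ Finset.range (n + 1),
    (T ε - 1).charpoly.coeff (k + m) * ((T ε - 1) ^ k) i j) / (T ε - 1).charpoly.coeff m,
    fun i j => ?_, ?_⟩
  · refine MeromorphicAt.fun_div (AnalyticAt.meromorphicAt ?_) (hc m).meromorphicAt
    exact Finset.analyticAt_fun_sum _ fun k _ => (hc _).mul (analyticAt_pow_apply hS k i j)
  · filter_upwards [hs, hm, hlt] with ε hs hm hlt i j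
    obtain ⟨q, hq⟩ := Polynomial.X_pow_dvd_iff.mpr fun k hk => hlt k (Finset.mem_range.mpr hk)
    have hcoeff : ∀ k, q.coeff k = (T ε - 1).charpoly.coeff (k + m) := fun k => by
      rw [hq, Polynomial.coeff_X_pow_mul]
    have hdeg : q.natDegree < n + 1 := by
      rw [Nat.lt_succ_iff, Polynomial.natDegree_le_iff_coeff_eq_zero]
      intro k hk
      rw [hcoeff]
      apply Polynomial.coeff_eq_zero_of_natDegree_lt
      rw [Matrix.charpoly_natDegree_eq_dim, Fintype.card_fin]
      omega
    have h := aeval_sub_one_eq_smul_spectralProjection hs hq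
    rw [Polynomial.aeval_eq_sum_range' hdeg] at h
    have h' := congrFun (congrFun h i) j
    simp only [Matrix.sum_apply, Matrix.smul_apply, smul_eq_mul, hcoeff, zero_add] at h'
    rw [h', mul_div_cancel_left₀ _ hm]

end Analytic

/-! ### The one-sided limit of the spectral projections -/

section Limit

open Filter Topology

theorem tendsto_smul_sub_matrixDeriv {n : ℕ} {T : ℝ → Matrix (Fin n) (Fin n) ℂ} {x : ℝ}
    (hT : ∀ i j, DifferentiableAt ℝ (fun ε => T ε i j) x) :
    Tendsto (fun ε => (ε - x)⁻¹ • (T ε - T x)) (𝓝[>] x) (𝓝 (matrixDeriv T x)) := by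
  refine tendsto_pi_nhds.mpr fun i => tendsto_pi_nhds.mpr fun j => ?_
  have h := (hasDerivAt_iff_tendsto_slope.mp (hT i j).hasDerivAt).mono_left
    (nhdsWithin_mono x fun y (hy : x < y) => (ne_of_gt hy : y ∈ ({x}ᶜ : Set ℝ)))
  exact h

end Limit

theorem lemma4p1 {n : ℕ}
    (N : AlgebraNorm ℂ (Matrix (Fin n) (Fin n) ℂ))
    (ε₀ : ℝ) (hε₀ : 0 < ε₀)
    (T : ℝ → Matrix (Fin n) (Fin n) ℂ)
    (hT : ∀ i j, AnalyticOnNhd ℝ (fun ε => T ε i j) (Set.Ioo (-ε₀) ε₀))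
    (hspec : ∀ ε ∈ Set.Ioo (-ε₀) ε₀, (1 : ℂ) ∈ spectrum ℂ (T ε))
    (hnorm : ∀ ε ∈ Set.Ioo (-ε₀) ε₀, N (T ε) = 1)
    (P : ℝ → Matrix (Fin n) (Fin n) ℂ)
    (hP : ∀ ε ∈ Set.Ioo (-ε₀) ε₀, P ε = spectralProjection (T ε) 1)
    (hconv : ∀ ε ∈ Set.Ioo 0 ε₀,
      Filter.Tendsto (fun k : ℕ => T ε ^ k) Filter.atTop (nhds (P ε)))
    (Q : Matrix (Fin n) (Fin n) ℂ)
    (hQ : Q = spectralProjection (P 0 * matrixDeriv T 0 * P 0) 0) :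
    (0 : ℂ) ∈ spectrum ℂ (P 0 * matrixDeriv T 0 * P 0) ∧
    (P 0 * Q = Q * P 0 ∧ IsIdempotentElem (P 0 * Q)) ∧
    ∃ P₀ : Matrix (Fin n) (Fin n) ℂ,
      Filter.Tendsto P (nhdsWithin 0 (Set.Ioi 0)) (nhds P₀) ∧
      IsSubprojection P₀ (P 0 * Q) := by
  have h0 : (0 : ℝ) ∈ Set.Ioo (-ε₀) ε₀ := ⟨neg_lt_zero.mpr hε₀, hε₀⟩
  have hpos : ∀ᶠ ε in nhdsWithin (0 : ℝ) (Set.Ioi 0), ε ∈ Set.Ioo 0 ε₀ :=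
    Ioo_mem_nhdsGT hε₀
  have hsub : ∀ {ε}, ε ∈ Set.Ioo 0 ε₀ → ε ∈ Set.Ioo (-ε₀) ε₀ :=
    fun h => ⟨(neg_lt_zero.mpr hε₀).trans h.1, h.2⟩
  have hidem : ∀ ε ∈ Set.Ioo (-ε₀) ε₀, IsIdempotentElem (P ε) := fun ε hε => by
    rw [hP ε hε]; exact isIdempotentElem_spectralProjection _ _
  have hleft : ∀ ε ∈ Set.Ioo (-ε₀) ε₀, (T ε - 1) * P ε = 0 := fun ε hε => by
    rw [hP ε hε]; exact AlgebraNorm.sub_one_mul_spectralProjection (hnorm ε hε).le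
  have hright : ∀ ε ∈ Set.Ioo (-ε₀) ε₀, P ε * (T ε - 1) = 0 := fun ε hε => by
    rw [hP ε hε]; exact AlgebraNorm.spectralProjection_mul_sub_one (hnorm ε hε).le
  have hle : ∀ ε ∈ Set.Ioo 0 ε₀, N (P ε) ≤ 1 := fun ε hε => by
    have ht := ((AlgebraNorm.continuous_matrix N).tendsto _).comp
      ((Filter.tendsto_add_atTop_iff_nat 1).mpr (hconv ε hε))
    exact le_of_tendsto' ht fun k => AlgebraNorm.pow_succ_le_one (hnorm ε (hsub hε)).le k
  have hge : ∀ ε ∈ Set.Ioo 0 ε₀, 1 ≤ N (P ε) := fun ε hε => by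
    refine AlgebraNorm.one_le_of_isIdempotentElem (hidem ε (hsub hε)) fun hz => ?_
    rw [hP ε (hsub hε)] at hz
    exact spectralProjection_ne_zero (hspec ε (hsub hε)) hz
  -- Existence of the limit: the entries of `P` are bounded and meromorphic.
  have hlim : ∃ P₀, Filter.Tendsto P (nhdsWithin 0 (Set.Ioi 0)) (nhds P₀) := by
    obtain ⟨F, hF, hPF⟩ := exists_meromorphicAt_spectralProjection (x := 0)
      (fun i j => hT i j 0 h0) (by
        filter_upwards [hpos] with ε hε
        rw [← hP ε (hsub hε)]
        exact hright ε (hsub hε))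
    have hPF' : ∀ᶠ ε in nhdsWithin (0 : ℝ) (Set.Ioi 0), ∀ i j, P ε i j = F i j ε := by
      filter_upwards [hpos, hPF] with ε hε h
      rwa [hP ε (hsub hε)]
    have hentry : ∀ i j, ∃ c, Filter.Tendsto (fun ε => P ε i j)
        (nhdsWithin 0 (Set.Ioi 0)) (nhds c) := by
      intro i j
      obtain ⟨C, hC⟩ := AlgebraNorm.exists_entry_le N i j
      obtain ⟨c, hc⟩ := (hF i j).exists_tendsto_of_bounded (C := C) (by
        filter_upwards [hpos, hPF'] with ε hε h
        have h1 : N (P ε) = 1 := le_antisymm (hle ε hε) (hge ε hε)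
        simpa [h, h1] using hC (P ε))
      exact ⟨c, hc.congr' (hPF'.mono fun ε h => (h i j).symm)⟩
    choose c hc using hentry
    exact ⟨Matrix.of c, tendsto_pi_nhds.mpr fun i => tendsto_pi_nhds.mpr fun j => hc i j⟩
  obtain ⟨P₀, hP₀⟩ := hlim
  have hTc : Filter.Tendsto T (nhdsWithin 0 (Set.Ioi 0)) (nhds (T 0)) :=
    tendsto_pi_nhds.mpr fun i => tendsto_pi_nhds.mpr fun j =>
      (hT i j 0 h0).continuousAt.tendsto.mono_left nhdsWithin_le_nhds
  have hDT := tendsto_smul_sub_matrixDeriv fun i j => (hT i j 0 h0).differentiableAt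
  simp only [sub_zero] at hDT
  have hP₀i : IsIdempotentElem P₀ := tendsto_nhds_unique
    ((hP₀.mul hP₀).congr' (hpos.mono fun ε hε => hidem ε (hsub hε))) hP₀
  have hP₀ne : P₀ ≠ 0 := by
    rintro rfl
    have h1 := ge_of_tendsto (((AlgebraNorm.continuous_matrix N).tendsto _).comp hP₀)
      (hpos.mono hge)
    rw [map_zero] at h1
    exact absurd h1 (by norm_num)
  have hTP₀ : (T 0 - 1) * P₀ = 0 := tendsto_nhds_unique
    ((hTc.sub_const 1).mul hP₀)
    (tendsto_const_nhds.congr' (hpos.mono fun ε hε => (hleft ε (hsub hε)).symm))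
  have hP₀T : P₀ * (T 0 - 1) = 0 := tendsto_nhds_unique
    (hP₀.mul (hTc.sub_const 1))
    (tendsto_const_nhds.congr' (hpos.mono fun ε hε => (hright ε (hsub hε)).symm))
  have hPP₀ : P 0 * P₀ = P₀ := by
    rw [hP 0 h0]
    exact spectralProjection_mul_eq_self _ _ (by rwa [map_one])
  have hP₀P : P₀ * P 0 = P₀ := by
    rw [hP 0 h0]
    exact mul_spectralProjection_eq_self _ _ (by rwa [map_one])
  -- Since `T ε * P ε = P ε` and `P 0 * T 0 = P 0`, the difference quotients of `T` vanish between
  -- `P 0` and `P ε`; likewise on the other side.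
  have hd : ∀ ε, T ε - T 0 = (T ε - 1) - (T 0 - 1) := fun ε => by abel
  have hBP₀ : P 0 * matrixDeriv T 0 * P₀ = 0 := tendsto_nhds_unique
    ((hDT.const_mul (P 0)).mul hP₀)
    (tendsto_const_nhds.congr' (hpos.mono fun ε hε => by
      dsimp only
      rw [mul_smul_comm, smul_mul_assoc, hd, mul_sub, hright 0 h0, sub_zero, mul_assoc,
        hleft ε (hsub hε), mul_zero, smul_zero]))
  have hP₀B : P₀ * matrixDeriv T 0 * P 0 = 0 := tendsto_nhds_unique
    ((hP₀.mul hDT).mul_const (P 0))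
    (tendsto_const_nhds.congr' (hpos.mono fun ε hε => by
      dsimp only
      rw [mul_smul_comm, smul_mul_assoc, hd, mul_sub, hright ε (hsub hε), zero_sub, neg_mul,
        mul_assoc, hleft 0 h0, mul_zero, neg_zero, smul_zero]))
  have hB₁ : (P 0 * matrixDeriv T 0 * P 0) * P₀ = 0 := by rw [mul_assoc, hPP₀, hBP₀]
  have hB₂ : P₀ * (P 0 * matrixDeriv T 0 * P 0) = 0 := by
    rw [← mul_assoc, ← mul_assoc, hP₀P, hP₀B]
  have hQP₀ : Q * P₀ = P₀ := by
    rw [hQ]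
    exact spectralProjection_mul_eq_self _ _ (by rwa [map_zero, sub_zero])
  have hP₀Q : P₀ * Q = P₀ := by
    rw [hQ]
    exact mul_spectralProjection_eq_self _ _ (by rwa [map_zero, sub_zero])
  have hcomm : Commute (P 0) Q := by
    rw [hQ]
    refine Commute.spectralProjection_right _ _ ?_
    change _ * _ = _ * _
    rw [mul_assoc _ (P 0) (P 0), ← mul_assoc (P 0), ← mul_assoc (P 0), (hidem 0 h0).eq]
  have hPQ : IsIdempotentElem (P 0 * Q) := (hidem 0 h0).mul_of_commute hcomm
    (by rw [hQ]; exact isIdempotentElem_spectralProjection _ _)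
  refine ⟨?_, ⟨hcomm.eq, hPQ⟩, P₀, hP₀, hP₀i, hPQ, ?_, ?_⟩
  · rw [spectrum.zero_mem_iff]
    exact fun hu => hP₀ne (hu.mul_right_eq_zero.mp hB₁)
  · rw [mul_assoc, hQP₀, hPP₀]
  · rw [← mul_assoc, hP₀P, hP₀Q]
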